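/- Let $n,m,k$ be nonnegative integers, let $0<a<1$ and $b\ge 0$ be real, and let $r_k,r_{k-1},\dots,r_1\ge 0$. *The game $\hat\Gamma(n,m,k)$.* There are $n$ time periods; the inspector has $m$ inspections and the inspectee has up to $k$ intended violations. If $n>m>0$ and $k>0$, then in the current period the inspector chooses whether to inspect and, simultaneously, the inspectee chooses between legal action and violation: - inspection and legal action: the game continues as $\hat\Gamma(n-1,m-1,k)$; - no inspection and legal action: it continues as $\hat\Gamma(n-1,m,k)$; - no inspection and violation: the inspector receives $-r_k$, the inspectee receives $r_k$, and the game continues as $\hat\Gamma(n-1,m,k-1)$; - inspection and violation: the game ends with the additional payoffs $-a\,r_k$ to the inspector and $-b\,r_k$ to the inspectee. If $m\ge n$ or $k=0$, the inspectee acts legally from then on and both further payoffs are $0$. If $m=0$, the game ends with the further payoffs $-\sum_{i=1}^{\min\{k,n\}}r_{k+1-i}$ to the inspector and $\sum_{i=1}^{\min\{k,n\}}r_{k+1-i}$ to the inspectee. A player's payoff is the sum of all amounts received. In $\hat\Gamma(n,m,k)$ both players know all past actions of both players at the start of each period. The game $\hat\Gamma'(n,m,k)$ differs only in that the inspector is not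 informed about the inspectee's action after a period without inspection, so that his choice can depend only on his own past actions. Let $$s(n,m)=\sum_{i=0}^m\binom ni b^{m-i},\qquad \hat s(n,m)=\sum_{i=0}^m\binom ni(-a)^{m-i},\qquad t(n,m,k)=\sum_{i=1}^k r_{k+1-i}\binom{n-i}{m},$$ where $\binom{x}{m}=0$ for every integer $x<m$ (including $x<0$). Then in every Nash equilibrium in behavior strategies of $\hat\Gamma(n,m,k)$, and in every Nash equilibrium in behavior strategies of $\hat\Gamma'(n,m,k)$, the expected payoffs $v(n,m,k)$ to the inspector and $w(n,m,k)$ to the inspectee are $$v(n,m,k)=\frac{-t(n,m,k)}{\hat s(n,m)},\qquad w(n,m,k)=\frac{t(n,m,k)}{s(n,m)}\qquad\text{if } m<n,$$ and $v(n,m,k)=w(n,m,k)=0$ if $m\ge n$. -/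

import Mathlib

namespace InspectionGame

/-- The inspector's choices in a time period. -/
inductive InspectorAction where
  | inspect
  | skip

/-- The inspectee's choices in a time period. -/
inductive InspecteeAction where
  | legal
  | violate

/-- The history of play before the current time period: the pairs of actions taken so far, the most
recent one first. -/
abbrev History : Type := List (InspectorAction × InspecteeAction)

/-- The inspector's own past actions, the most recent one first. -/
abbrev OwnHistory : Type := List InspectorAction

/-- Behavior strategies of the fully informed inspector: for every history, the probability of
inspecting in the current period. -/
abbrev InspectorStrategy : Type := History → unitInterval

/-- Behavior strategies of the inspector who is not told the inspectee's action after a period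
without inspection. A violation in an inspected period ends the game, so as long as he has to move
his information is precisely the list of his own past actions. -/
abbrev UninformedInspectorStrategy : Type := OwnHistory → unitInterval

/-- Behavior strategies of the inspectee: for every history (he observes the inspector's past
actions and knows his own, but not the inspector's current action), the probability of violating in
the current period. -/
abbrev InspecteeStrategy : Type := History → unitInterval

/-- An uninformed inspector's strategy prescribes the same behavior after all histories that he
cannot tell apart. -/
def UninformedInspectorStrategy.toInspectorStrategy (σ : UninformedInspectorStrategy) :
    InspectorStrategy :=
  fun h => σ (h.map Prod.fst)

/-- `expectedPayoff r c g σ τ n m k h` is the expected payoff that a player still collects when `n`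
periods, `m` inspections and `k` intended violations remain after the history `h`, where that player
gets `c * r k` if a violation is caught (which ends the game) and `g * r k` for an uncaught one,
whose reward is `r k`. If every remaining period can be inspected, or if no violations are
intended any more, the inspectee acts legally from now on; if no inspections remain, he collects
the next rewards, one in each period. In all other cases both players choose independently. -/
noncomputable def expectedPayoff (r : ℕ → ℝ) (c g : ℝ)
    (σ : InspectorStrategy) (τ : InspecteeStrategy) : ℕ → ℕ → ℕ → History → ℝ
  | 0, _, _, _ => 0
  | n + 1, m, k, h =>
    if n + 1 ≤ m ∨ k = 0 then 0
    else if m = 0 then g * ∑ i ∈ Finset.Icc 1 (min k (n + 1)), r (k + 1 - i)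
    else
      (σ h : ℝ) * (1 - (τ h : ℝ)) *
          expectedPayoff r c g σ τ n (m - 1) k ((.inspect, .legal) :: h)
        + (σ h : ℝ) * (τ h : ℝ) * (c * r k)
        + (1 - (σ h : ℝ)) * (1 - (τ h : ℝ)) *
          expectedPayoff r c g σ τ n m k ((.skip, .legal) :: h)
        + (1 - (σ h : ℝ)) * (τ h : ℝ) *
          (g * r k + expectedPayoff r c g σ τ n m (k - 1) ((.skip, .violate) :: h))

/-- The inspector's expected payoff in the game with `n` periods, `m` inspections and `k` intended
violations: a caught violation costs him `a * r k`, an uncaught one costs him `r k`. -/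
noncomputable def inspectorPayoff (n m k : ℕ) (a : ℝ) (r : ℕ → ℝ)
    (σ : InspectorStrategy) (τ : InspecteeStrategy) : ℝ :=
  expectedPayoff r (-a) (-1) σ τ n m k []

/-- The inspectee's expected payoff: a caught violation costs him `b * r k`, an uncaught one earns
him `r k`. -/
noncomputable def inspecteePayoff (n m k : ℕ) (b : ℝ) (r : ℕ → ℝ)
    (σ : InspectorStrategy) (τ : InspecteeStrategy) : ℝ :=
  expectedPayoff r (-b) 1 σ τ n m k []

/-- Nash equilibrium of a two-player game with strategy sets `S` and `T` and payoff functions `u`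
(first player) and `u'` (second player). -/
def IsNashEquilibrium {S T : Type} (u u' : S → T → ℝ) (σ : S) (τ : T) : Prop :=
  (∀ σ₁ : S, u σ₁ τ ≤ u σ τ) ∧ (∀ τ₁ : T, u' σ τ₁ ≤ u' σ τ)

/-- `s b n m = ∑_{i=0}^m (n choose i) b^(m-i)`. -/
noncomputable def s (b : ℝ) (n m : ℕ) : ℝ :=
  ∑ i ∈ Finset.range (m + 1), (n.choose i : ℝ) * b ^ (m - i)

/-- `t r n m k = ∑_{i=1}^k r_{k+1-i} ((n-i) choose m)`, where the binomial coefficient is zero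
for `i > n`. -/
noncomputable def t (r : ℕ → ℝ) (n m k : ℕ) : ℝ :=
  ∑ i ∈ Finset.Icc 1 k, r (k + 1 - i) * (if i ≤ n then ((n - i).choose m : ℝ) else 0)

/-- The claimed payoff to the inspector, with `ŝ(n,m) = s (-a) n m` in the denominator. -/
noncomputable def v (a : ℝ) (r : ℕ → ℝ) (n m k : ℕ) : ℝ :=
  if n ≤ m then 0 else -t r n m k / s (-a) n m

/-- The claimed payoff to the inspectee. -/
noncomputable def w (b : ℝ) (r : ℕ → ℝ) (n m k : ℕ) : ℝ :=
  if n ≤ m then 0 else t r n m k / s b n m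

end InspectionGame

/-!
The inspector's loss (minus his payoff) and the inspectee's payoff are two instances of one payoff,
in which an uncaught violation yields its reward and a caught one yields `-x` times the reward, with
`x = -a` for the former and `x = b` for the latter. Let `value x = t / s x`. Pascal's recursions for
`s` and `t` show that if the current period is inspected with probability `inspectProb x`, and the
continuation payoffs are given by `value x`, then legal action and violation lead to the same payoff
`value x` (`value_legal`, `value_violate`). This probability does not depend on the number of
intended violations. So the inspector, even if uninformed, has a strategy with which his loss is
`value (-a)` whatever the inspectee does; likewise the inspectee can make his own payoff equal to
`value b` whatever the inspector does (`exists_inspector_equalizer`, `exists_inspectee_equalizer`).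

Both information structures are treated at once: the inspector remembers a signal `f z` of each pair
`z` of actions. The induction on the number of periods concerns an information set of the inspector,
with a finite family of weighted types of the inspectee located there
(`IsContinuationEquilibrium`). Continuations reached with positive probability are again equilibria,
so they have the claimed payoffs; in unreached ones a deviating player secures at least his claimed
payoff with an equalizing strategy. Off-path behavior thus plays no role, and both players
evaluate the current period with the claimed continuation payoffs. If some type can still gain
(`t > 0`), the period must be inspected with probability exactly `inspectProb b`: with less
inspection all such types would violate, and the inspector would strictly prefer to inspect
(`caught_lt_uncaught`); with more they would all act legally, and he would strictly prefer not to
(`value_succ_lt`). Hence each type is indifferent and gets `value b`. The inspector randomizes, so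
his two actions are equally good, and averaging them with weights `inspectProb (-a)` shows that his
loss is the total of `value (-a)`. Types with `t = 0` can only collect vanishing rewards
(`expectedPayoff_eq_zero`).
-/

namespace InspectionGame

/-! ### Binomial sums -/

lemma s_zero_right (x : ℝ) (n : ℕ) : s x n 0 = 1 := by simp [s]

lemma s_succ_right (x : ℝ) (n m : ℕ) :
    s x n (m + 1) = n.choose (m + 1) + x * s x n m := by
  rw [s, Finset.sum_range_succ, s, Finset.mul_sum, add_comm]
  congr 1
  · simp
  · refine Finset.sum_congr rfl fun i hi => ?_
    rw [Nat.succ_sub (Nat.lt_succ_iff.mp (Finset.mem_range.mp hi)), pow_succ]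
    ring

lemma s_pascal (x : ℝ) (n m : ℕ) :
    s x (n + 1) (m + 1) = s x n m + s x n (m + 1) := by
  induction m with
  | zero => simp [s_succ_right, s_zero_right]; ring
  | succ m ih =>
    rw [s_succ_right, ih, s_succ_right x n (m + 1), s_succ_right x n m, Nat.choose_succ_succ]
    push_cast
    ring

lemma s_self (x : ℝ) (n : ℕ) : s x n n = (1 + x) ^ n := by
  rw [s, add_pow]
  exact Finset.sum_congr rfl fun i _ => by ring

lemma s_pos {x : ℝ} (hx : -1 < x) {n m : ℕ} (h : m ≤ n) : 0 < s x n m := by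
  induction n generalizing m with
  | zero => obtain rfl := Nat.le_zero.mp h; simp [s_zero_right]
  | succ n ih =>
    rcases m with _ | m
    · simp [s_zero_right]
    · rcases h.eq_or_lt with h | h
      · rw [h, s_self]
        exact pow_pos (by linarith) _
      · rw [s_pascal]
        exact add_pos (ih (by omega)) (ih (by omega))

/-- The difference of the two sides satisfies Pascal's recursion, and is positive at the boundary
cases `m = 0` and `m + 1 = n`. -/
lemma sub_mul_s_lt {x : ℝ} (hx : -1 < x) {n m : ℕ} (h : m + 1 ≤ n) :
    ((n : ℝ) - (m + 1)) * s x n m < (m + 1) * s x n (m + 1) := by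
  induction n generalizing m with
  | zero => omega
  | succ n ih =>
    rcases h.eq_or_lt with h' | h'
    · have := s_pos hx h
      have h0 : ((n + 1 : ℕ) : ℝ) - (m + 1) = 0 := by rw [← h']; push_cast; ring
      rw [h0, zero_mul]
      positivity
    · rcases m with _ | m
      · simp [s_succ_right, s_zero_right]
        linarith
      · have h1 := ih (m := m + 1) (by omega)
        have h2 := ih (m := m) (by omega)
        rw [s_pascal, s_pascal x n (m + 1)]
        push_cast at h1 h2 ⊢
        linarith

lemma t_eq_sum_range (r : ℕ → ℝ) (n m k : ℕ) :
    t r n m k = ∑ j ∈ Finset.range k,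
      r (k - j) * (if j < n then ((n - 1 - j).choose m : ℝ) else 0) := by
  have h : Finset.Icc 1 k = Finset.Ico 1 (k + 1) := by ext; simp
  rw [t, h, Finset.sum_Ico_eq_sum_range]
  refine Finset.sum_congr (by simp) fun j _ => ?_
  have h1 : k + 1 - (1 + j) = k - j := by omega
  have h2 : n - (1 + j) = n - 1 - j := by omega
  rw [h1, h2]
  simp only [show (1 + j ≤ n) ↔ j < n by omega]

lemma t_zero_right (r : ℕ → ℝ) (n m : ℕ) : t r n m 0 = 0 := by simp [t]

lemma t_succ_left {r : ℕ → ℝ} (hr0 : r 0 = 0) (n m k : ℕ) :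
    t r (n + 1) m k = r k * n.choose m + t r n m (k - 1) := by
  rcases k with _ | k
  · simp [t_zero_right, hr0]
  · rw [t_eq_sum_range, t_eq_sum_range, Finset.sum_range_succ',
      add_comm (r (k + 1) * _)]
    congr 1
    refine Finset.sum_congr rfl fun j _ => ?_
    have h1 : k + 1 - (j + 1) = k + 1 - 1 - j := by omega
    have h2 : n + 1 - 1 - (j + 1) = n - 1 - j := by omega
    rw [h1, h2]
    simp only [Nat.add_lt_add_iff_right]

lemma t_pascal (r : ℕ → ℝ) (n m k : ℕ) :
    t r (n + 1) (m + 1) k = t r n m k + t r n (m + 1) k := by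
  simp only [t_eq_sum_range, ← Finset.sum_add_distrib]
  refine Finset.sum_congr rfl fun j _ => ?_
  rcases lt_trichotomy j n with h | h | h
  · have h1 : n + 1 - 1 - j = (n - 1 - j) + 1 := by omega
    rw [if_pos h, if_pos h, if_pos (by omega), h1, Nat.choose_succ_succ]
    push_cast
    ring
  · subst h
    simp
  · rw [if_neg (by omega), if_neg (by omega), if_neg (by omega)]
    ring

lemma t_eq_zero_of_le (r : ℕ → ℝ) {n m : ℕ} (k : ℕ) (h : n ≤ m) : t r n m k = 0 := by
  rw [t_eq_sum_range]
  refine Finset.sum_eq_zero fun j _ => ?_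
  split_ifs with hj
  · rw [Nat.choose_eq_zero_of_lt (by omega)]
    simp
  · simp

lemma t_nonneg {r : ℕ → ℝ} (hr : ∀ i, 0 ≤ r i) (n m k : ℕ) : 0 ≤ t r n m k := by
  rw [t_eq_sum_range]
  refine Finset.sum_nonneg fun j _ => mul_nonneg (hr _) ?_
  split_ifs <;> positivity

lemma succ_mul_t_le {r : ℕ → ℝ} (hr : ∀ i, 0 ≤ r i) {n m : ℕ} (k : ℕ) (h : m + 1 ≤ n) :
    ((m : ℝ) + 1) * t r n (m + 1) k ≤ (n - (m + 1)) * t r n m k := by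
  simp only [t_eq_sum_range, Finset.mul_sum]
  refine Finset.sum_le_sum fun j _ => ?_
  rw [mul_left_comm, mul_left_comm ((n : ℝ) - (m + 1))]
  refine mul_le_mul_of_nonneg_left ?_ (hr _)
  split_ifs with hj
  · have h1 : ((m : ℝ) + 1) * ((n - 1 - j).choose (m + 1) : ℝ) =
        ((n - 1 - j - m : ℕ) : ℝ) * ((n - 1 - j).choose m : ℝ) := by
      have := Nat.choose_succ_right_eq (n - 1 - j) m
      have h2 : (((n - 1 - j).choose (m + 1) * (m + 1) : ℕ) : ℝ) =
        ((n - 1 - j).choose m * (n - 1 - j - m) : ℕ) := by rw [this]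
      rw [Nat.cast_mul, Nat.cast_mul] at h2
      push_cast at h2 ⊢
      linarith
    rw [h1]
    refine mul_le_mul_of_nonneg_right ?_ (by positivity)
    have h3 : ((n - (m + 1) : ℕ) : ℝ) = n - (m + 1) := by push_cast [h]; ring
    rw [← h3]
    exact_mod_cast (by omega : n - 1 - j - m ≤ n - (m + 1))
  · simp

/-! ### The value and its recursion -/

/-- The claimed payoff `t / s` to the inspectee in the game where a caught violation costs him
`x` times the reward. With `x = -a` it is the claimed loss of the inspector. -/
noncomputable def value (x : ℝ) (r : ℕ → ℝ) (n m k : ℕ) : ℝ := t r n m k / s x n m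

/-- The inspection probability, with `n + 1` periods and `m + 1` inspections left, that makes an
inspectee with penalty factor `x` indifferent. It does not depend on the number of intended
violations. -/
noncomputable def inspectProb (x : ℝ) (n m : ℕ) : ℝ := s x n m / s x (n + 1) (m + 1)

section

variable {x : ℝ} {r : ℕ → ℝ} {n m k : ℕ}

lemma inspectProb_pos (hx : -1 < x) (h : m + 1 ≤ n) : 0 < inspectProb x n m :=
  div_pos (s_pos hx (by omega)) (s_pos hx (by omega))

lemma one_sub_inspectProb (hx : -1 < x) (h : m + 1 ≤ n) :
    1 - inspectProb x n m = s x n (m + 1) / s x (n + 1) (m + 1) := by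
  have := s_pos hx (show m + 1 ≤ n + 1 by omega)
  rw [inspectProb, eq_div_iff this.ne', sub_mul, div_mul_cancel₀ _ this.ne', s_pascal]
  ring

lemma inspectProb_lt_one (hx : -1 < x) (h : m + 1 ≤ n) : inspectProb x n m < 1 := by
  have := one_sub_inspectProb hx h
  have := div_pos (s_pos hx h) (s_pos hx (show m + 1 ≤ n + 1 by omega))
  linarith

lemma value_nonneg (hx : -1 < x) (hr : ∀ i, 0 ≤ r i) (h : m ≤ n) : 0 ≤ value x r n m k :=
  div_nonneg (t_nonneg hr _ _ _) (s_pos hx h).le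

lemma value_legal (hx : -1 < x) (h : m + 1 ≤ n) :
    inspectProb x n m * value x r n m k + (1 - inspectProb x n m) * value x r n (m + 1) k =
      value x r (n + 1) (m + 1) k := by
  have h1 := s_pos hx (show m ≤ n by omega)
  have h2 := s_pos hx h
  have h3 := s_pos hx (show m + 1 ≤ n + 1 by omega)
  rw [one_sub_inspectProb hx h, inspectProb, value, value, value, t_pascal]
  field_simp

lemma value_violate (hx : -1 < x) (hr0 : r 0 = 0) (h : m + 1 ≤ n) :
    inspectProb x n m * (-x * r k) +
        (1 - inspectProb x n m) * (r k + value x r n (m + 1) (k - 1)) =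
      value x r (n + 1) (m + 1) k := by
  have h2 := s_pos hx h
  have h3 := s_pos hx (show m + 1 ≤ n + 1 by omega)
  rw [one_sub_inspectProb hx h, inspectProb, value, value, t_succ_left hr0]
  have h4 := s_succ_right x n m
  field_simp
  rw [h4]
  ring

/-- If the claimed payoff vanishes, then so do the current reward and the claimed payoffs in all
continuations. -/
lemma eq_zero_of_t_eq_zero (hr : ∀ i, 0 ≤ r i) (hr0 : r 0 = 0) (h : m + 1 ≤ n)
    (ht : t r (n + 1) (m + 1) k = 0) :
    r k = 0 ∧ t r n m k = 0 ∧ t r n (m + 1) k = 0 ∧ t r n (m + 1) (k - 1) = 0 := by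
  have h1 := t_pascal r n m k
  have h2 := t_succ_left hr0 n (m + 1) k
  have h3 := t_nonneg hr n m k
  have h4 := t_nonneg hr n (m + 1) k
  have h5 := t_nonneg hr n (m + 1) (k - 1)
  have hc : (0 : ℝ) < n.choose (m + 1) := by exact_mod_cast Nat.choose_pos h
  have h6 := mul_nonneg (hr k) hc.le
  refine ⟨?_, by linarith, by linarith, by linarith⟩
  have h7 : r k * n.choose (m + 1) = 0 := by linarith
  exact (mul_eq_zero.mp h7).resolve_right hc.ne'

lemma t_pos_of_t_pos (hr : ∀ i, 0 ≤ r i) (h : m + 1 ≤ n)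
    (ht : 0 < t r (n + 1) (m + 1) k) : 0 < t r n m k := by
  rw [t_pascal] at ht
  by_contra h0
  have h0 : t r n m k = 0 := le_antisymm (not_lt.mp h0) (t_nonneg hr _ _ _)
  have h1 := succ_mul_t_le hr k h
  rw [h0, mul_zero] at h1
  rw [h0, zero_add] at ht
  have : 0 < ((m : ℝ) + 1) * t r n (m + 1) k := by positivity
  linarith

/-- Fewer inspections strictly help an inspectee who can still gain. -/
lemma value_succ_lt (hx : -1 < x) (hr : ∀ i, 0 ≤ r i) (h : m + 1 ≤ n) (ht : 0 < t r n m k) :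
    value x r n (m + 1) k < value x r n m k := by
  have h1 := s_pos hx (show m ≤ n by omega)
  have h2 := s_pos hx h
  rw [value, value, div_lt_div_iff₀ h2 h1]
  have h3 := mul_le_mul_of_nonneg_right (succ_mul_t_le hr k h) h1.le
  have h4 := mul_lt_mul_of_pos_right (sub_mul_s_lt hx h) ht
  have hm : (0 : ℝ) < m + 1 := by positivity
  refine lt_of_mul_lt_mul_left ?_ hm.le
  linarith

lemma value_succ_le (hx : -1 < x) (hr : ∀ i, 0 ≤ r i) (h : m + 1 ≤ n) :
    value x r n (m + 1) k ≤ value x r n m k := by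
  rcases (t_nonneg hr n m k).eq_or_lt with h0 | h0
  · have h1 := succ_mul_t_le hr k h
    rw [← h0, mul_zero] at h1
    have h2 : t r n (m + 1) k ≤ 0 := nonpos_of_mul_nonpos_right h1 (by positivity)
    rw [value, value, ← h0, zero_div]
    exact div_nonpos_of_nonpos_of_nonneg h2 (s_pos hx h).le
  · exact (value_succ_lt hx hr h h0).le

end

/-! ### Expected payoffs -/

/-- Strategies matter only at continuations of the current history. -/
lemma expectedPayoff_congr_strategy (r : ℕ → ℝ) (c g : ℝ) {σ σ' : InspectorStrategy}
    {τ τ' : InspecteeStrategy} (n m k : ℕ) (h : History)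
    (hσ : ∀ l, h <:+ l → σ l = σ' l) (hτ : ∀ l, h <:+ l → τ l = τ' l) :
    expectedPayoff r c g σ τ n m k h = expectedPayoff r c g σ' τ' n m k h := by
  induction n generalizing m k h with
  | zero => simp [expectedPayoff]
  | succ n ih =>
    have key : ∀ (z : InspectorAction × InspecteeAction) (m k : ℕ),
        expectedPayoff r c g σ τ n m k (z :: h) = expectedPayoff r c g σ' τ' n m k (z :: h) :=
      fun z m k => ih m k (z :: h)
        (fun l hl => hσ l ((List.suffix_cons z h).trans hl))
        (fun l hl => hτ l ((List.suffix_cons z h).trans hl))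
    rw [expectedPayoff, expectedPayoff, hσ h List.suffix_rfl, hτ h List.suffix_rfl, key, key, key]

lemma expectedPayoff_congr_reward {r r' : ℕ → ℝ} (c g : ℝ) (σ : InspectorStrategy)
    (τ : InspecteeStrategy) (n m k : ℕ) (h : History)
    (hr : ∀ i, 1 ≤ i → i ≤ k → r i = r' i) :
    expectedPayoff r c g σ τ n m k h = expectedPayoff r' c g σ τ n m k h := by
  induction n generalizing m k h with
  | zero => simp [expectedPayoff]
  | succ n ih =>
    rw [expectedPayoff, expectedPayoff]
    split_ifs with h1 h2
    · rfl
    · congr 1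
      refine Finset.sum_congr rfl fun i hi => ?_
      rw [Finset.mem_Icc] at hi
      exact hr _ (by omega) (by omega)
    · rw [ih _ _ _ hr, ih _ _ _ hr, ih m (k - 1) _ fun i h1 h2 => hr i h1 (by omega),
        hr k (by omega) le_rfl]

lemma t_congr_reward {r r' : ℕ → ℝ} (n m k : ℕ) (hr : ∀ i, 1 ≤ i → i ≤ k → r i = r' i) :
    t r n m k = t r' n m k := by
  refine Finset.sum_congr rfl fun i hi => ?_
  rw [Finset.mem_Icc] at hi
  rw [hr _ (by omega) (by omega)]

lemma expectedPayoff_neg (r : ℕ → ℝ) (c g : ℝ) (σ : InspectorStrategy)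
    (τ : InspecteeStrategy) (n m k : ℕ) (h : History) :
    expectedPayoff r (-c) (-g) σ τ n m k h = -expectedPayoff r c g σ τ n m k h := by
  induction n generalizing m k h with
  | zero => simp [expectedPayoff]
  | succ n ih =>
    rw [expectedPayoff, expectedPayoff, ih, ih, ih]
    split_ifs
    · simp
    · ring
    · ring

lemma expectedPayoff_of_le (r : ℕ → ℝ) (c g : ℝ) (σ : InspectorStrategy)
    (τ : InspecteeStrategy) {n m : ℕ} (k : ℕ) (h : History) (hm : n ≤ m) :
    expectedPayoff r c g σ τ n m k h = 0 := by
  rcases n with _ | n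
  · rw [expectedPayoff]
  · rw [expectedPayoff, if_pos (Or.inl hm)]

lemma expectedPayoff_zero_inspections (r : ℕ → ℝ) (c : ℝ) (σ : InspectorStrategy)
    (τ : InspecteeStrategy) (n k : ℕ) (h : History) :
    expectedPayoff r c 1 σ τ n 0 k h = t r n 0 k := by
  rcases n with _ | n
  · rw [expectedPayoff, t_eq_zero_of_le r k le_rfl]
  · rcases Nat.eq_zero_or_pos k with rfl | hk
    · rw [expectedPayoff, t_zero_right, if_pos (Or.inr rfl)]
    · rw [expectedPayoff, if_neg (by omega), if_pos rfl, one_mul, t]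
      have h1 : Finset.Icc 1 (min k (n + 1)) = (Finset.Icc 1 k).filter (· ≤ n + 1) := by
        ext; simp; omega
      rw [h1, Finset.sum_filter]
      exact Finset.sum_congr rfl fun i _ => by simp

/-- Games in which the players have nothing to decide. -/
lemma expectedPayoff_eq_value_of_trivial (r : ℕ → ℝ) (c x : ℝ) (σ : InspectorStrategy)
    (τ : InspecteeStrategy) {n m : ℕ} (k : ℕ) (h : History) (hm : n ≤ m ∨ m = 0) :
    expectedPayoff r c 1 σ τ n m k h = value x r n m k := by
  rcases hm with hm | rfl
  · rw [expectedPayoff_of_le r c 1 σ τ k h hm, value, t_eq_zero_of_le r k hm, zero_div]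
  · rw [expectedPayoff_zero_inspections, value, s_zero_right, div_one]

/-- The recursion, valid also for `k = 0` because `r 0 = 0`. -/
lemma expectedPayoff_succ {r : ℕ → ℝ} (hr0 : r 0 = 0) (c : ℝ) (σ : InspectorStrategy)
    (τ : InspecteeStrategy) {n m : ℕ} (k : ℕ) (h : History) (hm : m + 1 ≤ n) :
    expectedPayoff r c 1 σ τ (n + 1) (m + 1) k h =
      σ h * ((1 - τ h) * expectedPayoff r c 1 σ τ n m k ((.inspect, .legal) :: h)
          + τ h * (c * r k))
        + (1 - σ h) * ((1 - τ h) * expectedPayoff r c 1 σ τ n (m + 1) k ((.skip, .legal) :: h)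
          + τ h * (r k + expectedPayoff r c 1 σ τ n (m + 1) (k - 1) ((.skip, .violate) :: h))) := by
  rcases Nat.eq_zero_or_pos k with rfl | hk
  · have h0 : ∀ n m h, expectedPayoff r c 1 σ τ n m 0 h = 0 := by
      intro n m h
      rcases n with _ | n
      · rw [expectedPayoff]
      · rw [expectedPayoff, if_pos (Or.inr rfl)]
    simp [h0, hr0]
  · rw [expectedPayoff, if_neg (by omega), if_neg (by omega), Nat.add_sub_cancel]
    ring

/-- If `t r n m k = 0`, then all rewards that can be collected before the end vanish. -/
lemma expectedPayoff_eq_zero {r : ℕ → ℝ} (hr : ∀ i, 0 ≤ r i) (hr0 : r 0 = 0) (c : ℝ)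
    (σ : InspectorStrategy) (τ : InspecteeStrategy) (n m k : ℕ) (h : History)
    (ht : t r n m k = 0) : expectedPayoff r c 1 σ τ n m k h = 0 := by
  induction n generalizing m k h with
  | zero => rw [expectedPayoff]
  | succ n ih =>
    rcases m with _ | m
    · rw [expectedPayoff_zero_inspections, ht]
    · rcases Nat.lt_or_ge m n with hm | hm
      · obtain ⟨h1, h2, h3, h4⟩ := eq_zero_of_t_eq_zero hr hr0 hm ht
        rw [expectedPayoff_succ hr0 c σ τ k h hm, ih _ _ _ h2, ih _ _ _ h3, ih _ _ _ h4, h1]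
        ring
      · exact expectedPayoff_of_le _ _ _ _ _ _ _ (by omega)

/-! ### Signals and strategies -/

/-- Strategies on the subtrees below three signals, at least the first of which is told apart from
the others, combine with a choice at the root. -/
lemma exists_glue {β γ : Type*} (o : List β) {x y z : β} (hxy : x ≠ y) (hxz : x ≠ z) (p : γ)
    (F G H : List β → γ) (hGH : y = z → G = H) :
    ∃ S : List β → γ, S o = p ∧ (∀ l, x :: o <:+ l → S l = F l) ∧
      (∀ l, y :: o <:+ l → S l = G l) ∧ (∀ l, z :: o <:+ l → S l = H l) := by
  classical
  have hne : ∀ u l, u :: o <:+ l → l ≠ o := by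
    rintro u l hl rfl
    simpa using hl.length_le
  have hhd : ∀ u v l, u :: o <:+ l → v :: o <:+ l → u = v := by
    intro u v l hu hv
    have := (List.suffix_of_suffix_length_le hu hv (by simp)).eq_of_length (by simp)
    exact (List.cons.inj this).1
  refine ⟨fun l => if l = o then p else if x :: o <:+ l then F l else
    if y :: o <:+ l then G l else H l, by simp, fun l hl => ?_, fun l hl => ?_, fun l hl => ?_⟩
  · simp only [if_neg (hne _ _ hl), if_pos hl]
  · simp only [if_neg (hne _ _ hl), if_pos hl, if_neg fun hx => hxy (hhd _ _ _ hx hl)]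
  · simp only [if_neg (hne _ _ hl), if_neg fun hx => hxz (hhd _ _ _ hx hl)]
    split_ifs with hy
    · rw [hGH (hhd _ _ _ hy hl)]
    · rfl

section

variable {α : Type} (f : InspectorAction × InspecteeAction → α)

/-- The inspector's behavior when he remembers only the signal `f z` of each pair `z` of actions.
The fully informed inspector has `f = id`, the uninformed one `f = Prod.fst`. -/
def signalStrategy (σ : List α → unitInterval) : InspectorStrategy := fun h => σ (h.map f)

/-- The inspector can combine any inspection probability at the signals `o` with any continuation
strategies, provided the latter agree if he cannot tell them apart. -/
lemma exists_inspector_deviation {r : ℕ → ℝ} (hr0 : r 0 = 0)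
    (hf : ∀ z, f (.inspect, .legal) ≠ f (.skip, z)) (o : List α) (p : unitInterval)
    (σI σL σV : List α → unitInterval)
    (hLV : f (.skip, .legal) = f (.skip, .violate) → σL = σV) :
    ∃ σ : List α → unitInterval, ∀ (h : History) (τ : InspecteeStrategy) (c : ℝ) (n m k : ℕ),
      h.map f = o → m + 1 ≤ n →
      expectedPayoff r c 1 (signalStrategy f σ) τ (n + 1) (m + 1) k h =
        p * ((1 - τ h) *
              expectedPayoff r c 1 (signalStrategy f σI) τ n m k ((.inspect, .legal) :: h)
            + τ h * (c * r k))
          + (1 - p) * ((1 - τ h) *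
              expectedPayoff r c 1 (signalStrategy f σL) τ n (m + 1) k ((.skip, .legal) :: h)
            + τ h * (r k + expectedPayoff r c 1 (signalStrategy f σV) τ n (m + 1) (k - 1)
              ((.skip, .violate) :: h))) := by
  obtain ⟨σ, h0, hI, hL, hV⟩ := exists_glue o (hf _) (hf _) p σI σL σV hLV
  refine ⟨σ, fun h τ c n m k ho hm => ?_⟩
  have hmap : ∀ z l, z :: h <:+ l → f z :: o <:+ l.map f := by
    intro z l hl
    simpa [ho] using hl.map f
  have hσ : signalStrategy f σ h = p := by rw [signalStrategy, ho, h0]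
  rw [expectedPayoff_succ hr0 _ _ _ _ _ hm, hσ,
    expectedPayoff_congr_strategy r c 1 n m k _
      (σ := signalStrategy f σ) (σ' := signalStrategy f σI)
      (fun l hl => hI _ (hmap _ _ hl)) (fun _ _ => rfl),
    expectedPayoff_congr_strategy r c 1 n (m + 1) k _
      (σ := signalStrategy f σ) (σ' := signalStrategy f σL)
      (fun l hl => hL _ (hmap _ _ hl)) (fun _ _ => rfl),
    expectedPayoff_congr_strategy r c 1 n (m + 1) (k - 1) _
      (σ := signalStrategy f σ) (σ' := signalStrategy f σV)
      (fun l hl => hV _ (hmap _ _ hl)) (fun _ _ => rfl)]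

/-- The inspectee can combine any violation probability with any continuation strategies. -/
lemma exists_inspectee_deviation {r : ℕ → ℝ} (hr0 : r 0 = 0) (h : History) (q : unitInterval)
    (τI τL τV : InspecteeStrategy) :
    ∃ τ : InspecteeStrategy, ∀ (σ : InspectorStrategy) (c : ℝ) (n m k : ℕ), m + 1 ≤ n →
      expectedPayoff r c 1 σ τ (n + 1) (m + 1) k h =
        σ h * ((1 - q) * expectedPayoff r c 1 σ τI n m k ((.inspect, .legal) :: h)
            + q * (c * r k))
          + (1 - σ h) * ((1 - q) * expectedPayoff r c 1 σ τL n (m + 1) k ((.skip, .legal) :: h)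
            + q * (r k + expectedPayoff r c 1 σ τV n (m + 1) (k - 1)
              ((.skip, .violate) :: h))) := by
  obtain ⟨τ, h0, hI, hL, hV⟩ := exists_glue h
    (x := ((.inspect, .legal) : InspectorAction × InspecteeAction)) (y := (.skip, .legal))
    (z := (.skip, .violate)) (by simp) (by simp) q τI τL τV (by simp)
  refine ⟨τ, fun σ c n m k hm => ?_⟩
  rw [expectedPayoff_succ hr0 _ _ _ _ _ hm, h0,
    expectedPayoff_congr_strategy r c 1 n m k _ (fun _ _ => rfl) hI,
    expectedPayoff_congr_strategy r c 1 n (m + 1) k _ (fun _ _ => rfl) hL,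
    expectedPayoff_congr_strategy r c 1 n (m + 1) (k - 1) _ (fun _ _ => rfl) hV]

/-! ### Equalizing strategies -/

/-- The inspector has a strategy under which the payoff does not depend on the inspectee. Since the
inspection probabilities `inspectProb` do not involve `k`, it serves for all numbers of intended
violations at once, and needs no more than the inspector's own past actions. -/
lemma exists_inspector_equalizer {r : ℕ → ℝ} (hr0 : r 0 = 0) {x : ℝ} (hx : -1 < x)
    (hf : ∀ z, f (.inspect, .legal) ≠ f (.skip, z)) (n m : ℕ) (o : List α) :
    ∃ σ : List α → unitInterval, ∀ (h : History) (τ : InspecteeStrategy) (k : ℕ), h.map f = o →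
      expectedPayoff r (-x) 1 (signalStrategy f σ) τ n m k h = value x r n m k := by
  induction n generalizing m o with
  | zero => exact ⟨0, fun h τ k _ => expectedPayoff_eq_value_of_trivial _ _ _ _ _ _ _ (by simp)⟩
  | succ n ih =>
    by_cases hm : n + 1 ≤ m ∨ m = 0
    · exact ⟨0, fun h τ k _ => expectedPayoff_eq_value_of_trivial _ _ _ _ _ _ _ hm⟩
    obtain ⟨m, rfl⟩ : ∃ m', m = m' + 1 := ⟨m - 1, by omega⟩
    have hm : m + 1 ≤ n := by omega
    choose F hF using ih
    obtain ⟨σ, hσ⟩ := exists_inspector_deviation f hr0 hf o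
      ⟨inspectProb x n m, (inspectProb_pos hx hm).le, (inspectProb_lt_one hx hm).le⟩
      (F m (f (.inspect, .legal) :: o)) (F (m + 1) (f (.skip, .legal) :: o))
      (F (m + 1) (f (.skip, .violate) :: o)) (fun h => by rw [h])
    refine ⟨σ, fun h τ k ho => ?_⟩
    rw [hσ h τ (-x) n m k ho hm, hF _ _ _ _ _ (by rw [List.map_cons, ho]),
      hF _ _ _ _ _ (by rw [List.map_cons, ho]), hF _ _ _ _ _ (by rw [List.map_cons, ho])]
    have h1 := value_legal (r := r) (k := k) hx hm
    have h2 := value_violate (k := k) hx hr0 hm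
    linear_combination (1 - (τ h : ℝ)) * h1 + (τ h : ℝ) * h2

end

/-- The inspectee has a strategy under which his payoff does not depend on the inspector. -/
lemma exists_inspectee_equalizer {r : ℕ → ℝ} (hr : ∀ i, 0 ≤ r i) (hr0 : r 0 = 0) {x : ℝ}
    (hx : 0 ≤ x) (n m k : ℕ) (h : History) :
    ∃ τ : InspecteeStrategy, ∀ σ : InspectorStrategy,
      expectedPayoff r (-x) 1 σ τ n m k h = value x r n m k := by
  have hx' : -1 < x := by linarith
  induction n generalizing m k h with
  | zero => exact ⟨0, fun σ => expectedPayoff_eq_value_of_trivial _ _ _ _ _ _ _ (by simp)⟩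
  | succ n ih =>
    by_cases hm : n + 1 ≤ m ∨ m = 0
    · exact ⟨0, fun σ => expectedPayoff_eq_value_of_trivial _ _ _ _ _ _ _ hm⟩
    obtain ⟨m, rfl⟩ : ∃ m', m = m' + 1 := ⟨m - 1, by omega⟩
    have hm : m + 1 ≤ n := by omega
    choose T hT using ih
    have h1 := value_legal (r := r) (k := k) hx' hm
    have h2 := value_violate (k := k) hx' hr0 hm
    have h3 := value_succ_le (k := k) hx' hr hm
    have h4 : 0 ≤ value x r n (m + 1) (k - 1) := value_nonneg hx' hr hm
    have h5 := hr k
    have h6 := mul_nonneg hx h5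
    -- `q` makes inspecting and not inspecting equally good against the inspectee
    obtain ⟨q, hq⟩ : ∃ q : unitInterval,
        (1 - q) * value x r n m k + q * (-x * r k) =
          (1 - q) * value x r n (m + 1) k + q * (r k + value x r n (m + 1) (k - 1)) := by
      set A := value x r n m k - value x r n (m + 1) k with hA
      set B := r k + value x r n (m + 1) (k - 1) + x * r k with hB
      have hA0 : 0 ≤ A := by linarith
      have hB0 : 0 ≤ B := by linarith
      refine ⟨⟨A / (A + B), div_nonneg hA0 (by linarith),
        div_le_one_of_le₀ (by linarith) (by linarith)⟩, ?_⟩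
      have hAB : A / (A + B) * (A + B) = A := by
        rcases (add_nonneg hA0 hB0).eq_or_lt with h0 | h0
        · rw [← h0]
          linarith
        · exact div_mul_cancel₀ _ h0.ne'
      linear_combination -hAB
    obtain ⟨τ, hτ⟩ := exists_inspectee_deviation hr0 h q
      (T m k ((.inspect, .legal) :: h)) (T (m + 1) k ((.skip, .legal) :: h))
      (T (m + 1) (k - 1) ((.skip, .violate) :: h))
    refine ⟨τ, fun σ => ?_⟩
    rw [hτ σ (-x) n m k hm, hT, hT, hT]
    linear_combination (1 - (q : ℝ)) * h1 + (q : ℝ) * h2 + ((σ h : ℝ) - inspectProb x n m) * hq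

/-! ### Equilibria at an information set of the inspector -/

section

variable {α : Type} (f : InspectorAction × InspecteeAction → α)

/-- Optimality of both players in the continuation of a game, from an information set of the
inspector on. He has received the signals `o` and faces finitely many types `i` of the inspectee,
with history `h i`, number `k i` of remaining intended violations and weight `π i`. The types need
not be distinct, and the weights need not sum to `1`. The inspector minimizes his total loss, and
the strategy of each type of positive weight is optimal. -/
structure IsContinuationEquilibrium (r : ℕ → ℝ) (a b : ℝ) (n m : ℕ) (o : List α) {ι : Type}
    [Fintype ι] (π : ι → ℝ) (k : ι → ℕ) (h : ι → History) (σ : List α → unitInterval)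
    (τ : InspecteeStrategy) : Prop where
  signals : ∀ i, (h i).map f = o
  nonneg : ∀ i, 0 ≤ π i
  inspector : ∀ σ' : List α → unitInterval,
    ∑ i, π i * expectedPayoff r a 1 (signalStrategy f σ) τ n m (k i) (h i) ≤
      ∑ i, π i * expectedPayoff r a 1 (signalStrategy f σ') τ n m (k i) (h i)
  inspectee : ∀ i, 0 < π i → ∀ τ' : InspecteeStrategy,
    expectedPayoff r (-b) 1 (signalStrategy f σ) τ' n m (k i) (h i) ≤
      expectedPayoff r (-b) 1 (signalStrategy f σ) τ n m (k i) (h i)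

/-- The payoffs in a continuation are the claimed ones: the expected total loss of the inspector,
and the payoff to each type of positive weight. -/
def HasValuePayoffs (r : ℕ → ℝ) (a b : ℝ) (n m : ℕ) {ι : Type} [Fintype ι] (π : ι → ℝ)
    (k : ι → ℕ) (h : ι → History) (σ : List α → unitInterval) (τ : InspecteeStrategy) : Prop :=
  ∑ i, π i * expectedPayoff r a 1 (signalStrategy f σ) τ n m (k i) (h i) =
      ∑ i, π i * value (-a) r n m (k i) ∧
    ∀ i, 0 < π i → expectedPayoff r (-b) 1 (signalStrategy f σ) τ n m (k i) (h i) =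
      value b r n m (k i)

namespace IsContinuationEquilibrium

variable {f} {r : ℕ → ℝ} {a b : ℝ} {n m : ℕ} {o : List α} {ι : Type} [Fintype ι] {π : ι → ℝ}
  {k : ι → ℕ} {h : ι → History} {σ : List α → unitInterval} {τ : InspecteeStrategy}

/-- No deviation of the inspector, composed of an inspection probability at the current information
set and continuation strategies, lowers his total loss. -/
lemma inspector_deviation (hr0 : r 0 = 0) (hf : ∀ z, f (.inspect, .legal) ≠ f (.skip, z))
    (hm : m + 1 ≤ n)
    (H : IsContinuationEquilibrium f r a b (n + 1) (m + 1) o π k h σ τ)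
    (p : unitInterval) (σI σL σV : List α → unitInterval)
    (hLV : f (.skip, .legal) = f (.skip, .violate) → σL = σV) :
    ∑ i, π i * expectedPayoff r a 1 (signalStrategy f σ) τ (n + 1) (m + 1) (k i) (h i) ≤
      p * ∑ i, π i * ((1 - τ (h i)) * expectedPayoff r a 1 (signalStrategy f σI) τ n m (k i)
            ((.inspect, .legal) :: h i) + τ (h i) * (a * r (k i)))
        + (1 - p) * ∑ i, π i * ((1 - τ (h i)) *
            expectedPayoff r a 1 (signalStrategy f σL) τ n (m + 1) (k i) ((.skip, .legal) :: h i)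
          + τ (h i) * (r (k i) + expectedPayoff r a 1 (signalStrategy f σV) τ n (m + 1) (k i - 1)
              ((.skip, .violate) :: h i))) := by
  obtain ⟨σ', hσ'⟩ := exists_inspector_deviation f hr0 hf o p σI σL σV hLV
  refine (H.inspector σ').trans_eq ?_
  rw [Finset.mul_sum, Finset.mul_sum, ← Finset.sum_add_distrib]
  refine Finset.sum_congr rfl fun i _ => ?_
  rw [hσ' (h i) τ a n m (k i) (H.signals i) hm]
  ring

/-- No deviation of a type of positive weight, composed of a violation probability and continuation
strategies, raises that type's payoff. -/
lemma inspectee_deviation (hr0 : r 0 = 0) (hm : m + 1 ≤ n)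
    (H : IsContinuationEquilibrium f r a b (n + 1) (m + 1) o π k h σ τ) {i : ι} (hi : 0 < π i)
    (q : unitInterval) (τI τL τV : InspecteeStrategy) :
    σ o * ((1 - q) * expectedPayoff r (-b) 1 (signalStrategy f σ) τI n m (k i)
            ((.inspect, .legal) :: h i) + q * (-b * r (k i)))
        + (1 - σ o) * ((1 - q) * expectedPayoff r (-b) 1 (signalStrategy f σ) τL n (m + 1) (k i)
            ((.skip, .legal) :: h i)
          + q * (r (k i) + expectedPayoff r (-b) 1 (signalStrategy f σ) τV n (m + 1) (k i - 1)
              ((.skip, .violate) :: h i))) ≤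
      expectedPayoff r (-b) 1 (signalStrategy f σ) τ (n + 1) (m + 1) (k i) (h i) := by
  obtain ⟨τ', hτ'⟩ := exists_inspectee_deviation hr0 (h i) q τI τL τV
  have h1 := H.inspectee i hi τ'
  rw [hτ' _ _ _ _ _ hm] at h1
  rwa [signalStrategy, H.signals i] at h1

lemma inspector_loss_eq (hr0 : r 0 = 0) (hm : m + 1 ≤ n)
    (H : IsContinuationEquilibrium f r a b (n + 1) (m + 1) o π k h σ τ) :
    ∑ i, π i * expectedPayoff r a 1 (signalStrategy f σ) τ (n + 1) (m + 1) (k i) (h i) =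
      σ o * ∑ i, π i * ((1 - τ (h i)) * expectedPayoff r a 1 (signalStrategy f σ) τ n m (k i)
            ((.inspect, .legal) :: h i) + τ (h i) * (a * r (k i)))
        + (1 - σ o) * ∑ i, π i * ((1 - τ (h i)) *
            expectedPayoff r a 1 (signalStrategy f σ) τ n (m + 1) (k i) ((.skip, .legal) :: h i)
          + τ (h i) * (r (k i) + expectedPayoff r a 1 (signalStrategy f σ) τ n (m + 1) (k i - 1)
              ((.skip, .violate) :: h i))) := by
  rw [Finset.mul_sum, Finset.mul_sum, ← Finset.sum_add_distrib]
  refine Finset.sum_congr rfl fun i _ => ?_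
  rw [expectedPayoff_succ hr0 _ _ _ _ _ hm, signalStrategy, H.signals i]
  ring

lemma inspectee_payoff_eq (hr0 : r 0 = 0) (hm : m + 1 ≤ n)
    (H : IsContinuationEquilibrium f r a b (n + 1) (m + 1) o π k h σ τ) (i : ι) :
    expectedPayoff r (-b) 1 (signalStrategy f σ) τ (n + 1) (m + 1) (k i) (h i) =
      σ o * ((1 - τ (h i)) * expectedPayoff r (-b) 1 (signalStrategy f σ) τ n m (k i)
            ((.inspect, .legal) :: h i) + τ (h i) * (-b * r (k i)))
        + (1 - σ o) * ((1 - τ (h i)) * expectedPayoff r (-b) 1 (signalStrategy f σ) τ n (m + 1)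
            (k i) ((.skip, .legal) :: h i)
          + τ (h i) * (r (k i) + expectedPayoff r (-b) 1 (signalStrategy f σ) τ n (m + 1) (k i - 1)
              ((.skip, .violate) :: h i))) := by
  rw [expectedPayoff_succ hr0 _ _ _ _ _ hm, signalStrategy, H.signals i]

/-- A continuation that is reached with positive probability is again an equilibrium. -/
lemma after_inspect (hr0 : r 0 = 0) (hf : ∀ z, f (.inspect, .legal) ≠ f (.skip, z))
    (hm : m + 1 ≤ n)
    (H : IsContinuationEquilibrium f r a b (n + 1) (m + 1) o π k h σ τ) (hp : 0 < (σ o : ℝ)) :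
    IsContinuationEquilibrium f r a b n m (f (.inspect, .legal) :: o)
      (fun i => π i * (1 - τ (h i))) k (fun i => (.inspect, .legal) :: h i) σ τ where
  signals i := by rw [List.map_cons, H.signals]
  nonneg i := mul_nonneg (H.nonneg i) (sub_nonneg.mpr (τ (h i)).2.2)
  inspector σ' := by
    have h1 := H.inspector_deviation hr0 hf hm (σ o) σ' σ σ fun _ => rfl
    rw [H.inspector_loss_eq hr0 hm] at h1
    have h2 := le_of_mul_le_mul_left (le_of_add_le_add_right h1) hp
    simp only [mul_add, Finset.sum_add_distrib, ← mul_assoc] at h2 ⊢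
    linarith
  inspectee i hi τ' := by
    have hπ : 0 < π i := (H.nonneg i).lt_of_ne fun h0 => by simp [← h0] at hi
    have hq : 0 < (1 - τ (h i) : ℝ) := pos_of_mul_pos_right hi hπ.le
    have h1 := H.inspectee_deviation hr0 hm hπ (τ (h i)) τ' τ τ
    rw [H.inspectee_payoff_eq hr0 hm] at h1
    have h2 := le_of_mul_le_mul_left (le_of_add_le_add_right h1) hp
    exact le_of_mul_le_mul_left (le_of_add_le_add_right h2) hq

lemma inspectee_after_skip_legal (hr0 : r 0 = 0) (hm : m + 1 ≤ n)
    (H : IsContinuationEquilibrium f r a b (n + 1) (m + 1) o π k h σ τ)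
    (hp : 0 < (1 - σ o : ℝ)) (i : ι) (hi : 0 < π i * (1 - τ (h i))) (τ' : InspecteeStrategy) :
    expectedPayoff r (-b) 1 (signalStrategy f σ) τ' n (m + 1) (k i) ((.skip, .legal) :: h i) ≤
      expectedPayoff r (-b) 1 (signalStrategy f σ) τ n (m + 1) (k i) ((.skip, .legal) :: h i) := by
  have hπ : 0 < π i := (H.nonneg i).lt_of_ne fun h0 => by simp [← h0] at hi
  have hq : 0 < (1 - τ (h i) : ℝ) := pos_of_mul_pos_right hi hπ.le
  have h1 := H.inspectee_deviation hr0 hm hπ (τ (h i)) τ τ' τ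
  rw [H.inspectee_payoff_eq hr0 hm] at h1
  have h2 := le_of_mul_le_mul_left (le_of_add_le_add_left h1) hp
  exact le_of_mul_le_mul_left (le_of_add_le_add_right h2) hq

lemma inspectee_after_skip_violate (hr0 : r 0 = 0) (hm : m + 1 ≤ n)
    (H : IsContinuationEquilibrium f r a b (n + 1) (m + 1) o π k h σ τ)
    (hp : 0 < (1 - σ o : ℝ)) (i : ι) (hi : 0 < π i * τ (h i)) (τ' : InspecteeStrategy) :
    expectedPayoff r (-b) 1 (signalStrategy f σ) τ' n (m + 1) (k i - 1)
        ((.skip, .violate) :: h i) ≤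
      expectedPayoff r (-b) 1 (signalStrategy f σ) τ n (m + 1) (k i - 1)
        ((.skip, .violate) :: h i) := by
  have hπ : 0 < π i := (H.nonneg i).lt_of_ne fun h0 => by simp [← h0] at hi
  have hq : 0 < (τ (h i) : ℝ) := pos_of_mul_pos_right hi hπ.le
  have h1 := H.inspectee_deviation hr0 hm hπ (τ (h i)) τ τ τ'
  rw [H.inspectee_payoff_eq hr0 hm] at h1
  have h2 := le_of_mul_le_mul_left (le_of_add_le_add_left h1) hp
  exact le_of_add_le_add_left (le_of_mul_le_mul_left (le_of_add_le_add_left h2) hq)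

lemma inspector_after_skip (hr0 : r 0 = 0) (hf : ∀ z, f (.inspect, .legal) ≠ f (.skip, z))
    (hm : m + 1 ≤ n)
    (H : IsContinuationEquilibrium f r a b (n + 1) (m + 1) o π k h σ τ)
    (hp : 0 < (1 - σ o : ℝ)) (σL σV : List α → unitInterval)
    (hLV : f (.skip, .legal) = f (.skip, .violate) → σL = σV) :
    ∑ i, π i * (1 - τ (h i)) *
          expectedPayoff r a 1 (signalStrategy f σ) τ n (m + 1) (k i) ((.skip, .legal) :: h i)
        + ∑ i, π i * τ (h i) * expectedPayoff r a 1 (signalStrategy f σ) τ n (m + 1) (k i - 1)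
            ((.skip, .violate) :: h i) ≤
      ∑ i, π i * (1 - τ (h i)) *
          expectedPayoff r a 1 (signalStrategy f σL) τ n (m + 1) (k i) ((.skip, .legal) :: h i)
        + ∑ i, π i * τ (h i) * expectedPayoff r a 1 (signalStrategy f σV) τ n (m + 1) (k i - 1)
            ((.skip, .violate) :: h i) := by
  have h1 := H.inspector_deviation hr0 hf hm (σ o) σ σL σV hLV
  rw [H.inspector_loss_eq hr0 hm] at h1
  have h2 := le_of_mul_le_mul_left (le_of_add_le_add_left h1) hp
  simp only [mul_add, Finset.sum_add_distrib, ← mul_assoc] at h2 ⊢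
  linarith

/-- After a period without inspection the inspector faces one information set, or two if he learns
the inspectee's action; in the former case the types that acted legally and those that violated form
a disjoint union. -/
lemma payoffs_after_skip (hr0 : r 0 = 0) (hf : ∀ z, f (.inspect, .legal) ≠ f (.skip, z))
    (hm : m + 1 ≤ n)
    (ih : ∀ (o : List α) {ι : Type} [Fintype ι] (π : ι → ℝ) (k : ι → ℕ) (h : ι → History),
      IsContinuationEquilibrium f r a b n (m + 1) o π k h σ τ →
        HasValuePayoffs f r a b n (m + 1) π k h σ τ)
    (H : IsContinuationEquilibrium f r a b (n + 1) (m + 1) o π k h σ τ)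
    (hp : 0 < (1 - σ o : ℝ)) :
    (∑ i, π i * (1 - τ (h i)) *
          expectedPayoff r a 1 (signalStrategy f σ) τ n (m + 1) (k i) ((.skip, .legal) :: h i)
        + ∑ i, π i * τ (h i) * expectedPayoff r a 1 (signalStrategy f σ) τ n (m + 1) (k i - 1)
            ((.skip, .violate) :: h i) =
      ∑ i, π i * (1 - τ (h i)) * value (-a) r n (m + 1) (k i)
        + ∑ i, π i * τ (h i) * value (-a) r n (m + 1) (k i - 1)) ∧
    (∀ i, 0 < π i * (1 - τ (h i)) →
      expectedPayoff r (-b) 1 (signalStrategy f σ) τ n (m + 1) (k i) ((.skip, .legal) :: h i) =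
        value b r n (m + 1) (k i)) ∧
    (∀ i, 0 < π i * τ (h i) →
      expectedPayoff r (-b) 1 (signalStrategy f σ) τ n (m + 1) (k i - 1)
        ((.skip, .violate) :: h i) = value b r n (m + 1) (k i - 1)) := by
  have hL0 : ∀ i, 0 ≤ π i * (1 - τ (h i)) := fun i =>
    mul_nonneg (H.nonneg i) (sub_nonneg.mpr (τ (h i)).2.2)
  have hV0 : ∀ i, 0 ≤ π i * τ (h i) := fun i => mul_nonneg (H.nonneg i) (τ (h i)).2.1
  by_cases hLV : f (.skip, .legal) = f (.skip, .violate)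
  · obtain ⟨h1, h2⟩ := ih (f (.skip, .legal) :: o)
      (Sum.elim (fun i => π i * (1 - τ (h i))) (fun i => π i * τ (h i)))
      (Sum.elim k (fun i => k i - 1))
      (Sum.elim (fun i => (.skip, .legal) :: h i) (fun i => (.skip, .violate) :: h i))
      { signals := by
          rintro (i | i)
          · simp [H.signals]
          · simp [H.signals, hLV]
        nonneg := by rintro (i | i); exacts [hL0 i, hV0 i]
        inspector := fun σ' => by
          simpa only [Fintype.sum_sum_type, Sum.elim_inl, Sum.elim_inr] using
            H.inspector_after_skip hr0 hf hm hp σ' σ' fun _ => rfl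
        inspectee := by
          rintro (i | i) hi
          · exact H.inspectee_after_skip_legal hr0 hm hp i hi
          · exact H.inspectee_after_skip_violate hr0 hm hp i hi }
    refine ⟨?_, fun i => h2 (.inl i), fun i => h2 (.inr i)⟩
    simpa only [Fintype.sum_sum_type, Sum.elim_inl, Sum.elim_inr] using h1
  · obtain ⟨h1, h2⟩ := ih (f (.skip, .legal) :: o) (fun i => π i * (1 - τ (h i))) k
      (fun i => (.skip, .legal) :: h i)
      { signals := fun i => by simp [H.signals]
        nonneg := hL0
        inspector := fun σ' => by
          have := H.inspector_after_skip hr0 hf hm hp σ' σ fun h => absurd h hLV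
          linarith
        inspectee := H.inspectee_after_skip_legal hr0 hm hp }
    obtain ⟨h3, h4⟩ := ih (f (.skip, .violate) :: o) (fun i => π i * τ (h i))
      (fun i => k i - 1) (fun i => (.skip, .violate) :: h i)
      { signals := fun i => by simp [H.signals]
        nonneg := hV0
        inspector := fun σ' => by
          have := H.inspector_after_skip hr0 hf hm hp σ σ' fun h => absurd h hLV
          linarith
        inspectee := H.inspectee_after_skip_violate hr0 hm hp }
    exact ⟨by rw [h1, h3], h2, h4⟩

/-- The claimed total loss of the inspector if he inspects in the current period, when type `i`
violates with probability `q i` and the continuation payoffs are the claimed ones. -/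
noncomputable def inspectLoss (r : ℕ → ℝ) (a : ℝ) (n m : ℕ) (π : ι → ℝ) (k : ι → ℕ) (q : ι → ℝ) :
    ℝ :=
  ∑ i, π i * ((1 - q i) * value (-a) r n m (k i) + q i * (a * r (k i)))

/-- The same as `inspectLoss` for a current period without inspection. -/
noncomputable def skipLoss (r : ℕ → ℝ) (a : ℝ) (n m : ℕ) (π : ι → ℝ) (k : ι → ℕ) (q : ι → ℝ) :
    ℝ :=
  ∑ i, π i * ((1 - q i) * value (-a) r n (m + 1) (k i)
    + q i * (r (k i) + value (-a) r n (m + 1) (k i - 1)))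

/-- By switching to an equalizing strategy after the current period, the inspector secures the
claimed loss in every continuation, whether or not play reaches it. -/
lemma inspector_loss_le (hr0 : r 0 = 0) (ha : a < 1)
    (hf : ∀ z, f (.inspect, .legal) ≠ f (.skip, z)) (hm : m + 1 ≤ n)
    (H : IsContinuationEquilibrium f r a b (n + 1) (m + 1) o π k h σ τ) (p : unitInterval) :
    ∑ i, π i * expectedPayoff r a 1 (signalStrategy f σ) τ (n + 1) (m + 1) (k i) (h i) ≤
      p * inspectLoss r a n m π k (fun i => τ (h i))
        + (1 - p) * skipLoss r a n m π k (fun i => τ (h i)) := by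
  have ha' : -1 < -a := by linarith
  choose F hF using exists_inspector_equalizer f hr0 ha' hf
  rw [neg_neg] at hF
  refine (H.inspector_deviation hr0 hf hm p (F n m (f (.inspect, .legal) :: o))
    (F n (m + 1) (f (.skip, .legal) :: o)) (F n (m + 1) (f (.skip, .violate) :: o))
    (fun h => by rw [h])).trans_eq ?_
  rw [inspectLoss, skipLoss]
  congr 2
  · refine Finset.sum_congr rfl fun i _ => ?_
    rw [hF _ _ _ _ _ _ (by rw [List.map_cons, H.signals])]
  · refine Finset.sum_congr rfl fun i _ => ?_
    rw [hF _ _ _ _ _ _ (by rw [List.map_cons, H.signals]),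
      hF _ _ _ _ _ _ (by rw [List.map_cons, H.signals])]

/-- By switching to an equalizing strategy after the current period, the inspectee secures the
claimed payoff in every continuation, whether or not play reaches it. -/
lemma le_inspectee_payoff (hr : ∀ i, 0 ≤ r i) (hr0 : r 0 = 0) (hb : 0 ≤ b) (hm : m + 1 ≤ n)
    (H : IsContinuationEquilibrium f r a b (n + 1) (m + 1) o π k h σ τ) {i : ι} (hi : 0 < π i)
    (q : unitInterval) :
    (1 - q) * (σ o * value b r n m (k i) + (1 - σ o) * value b r n (m + 1) (k i))
        + q * (σ o * (-b * r (k i)) + (1 - σ o) * (r (k i) + value b r n (m + 1) (k i - 1))) ≤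
      expectedPayoff r (-b) 1 (signalStrategy f σ) τ (n + 1) (m + 1) (k i) (h i) := by
  choose T hT using exists_inspectee_equalizer hr hr0 hb
  have h1 := H.inspectee_deviation hr0 hm hi q (T n m (k i) ((.inspect, .legal) :: h i))
    (T n (m + 1) (k i) ((.skip, .legal) :: h i))
    (T n (m + 1) (k i - 1) ((.skip, .violate) :: h i))
  rw [hT, hT, hT] at h1
  linarith

/-- Continuations that are reached are equilibria and have the claimed payoffs; the others do not
count. -/
lemma inspector_loss_eq_of_value (hr0 : r 0 = 0) (hf : ∀ z, f (.inspect, .legal) ≠ f (.skip, z))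
    (hm : m + 1 ≤ n)
    (ih : ∀ (m : ℕ) (o : List α) {ι : Type} [Fintype ι] (π : ι → ℝ) (k : ι → ℕ)
      (h : ι → History), IsContinuationEquilibrium f r a b n m o π k h σ τ →
        HasValuePayoffs f r a b n m π k h σ τ)
    (H : IsContinuationEquilibrium f r a b (n + 1) (m + 1) o π k h σ τ) :
    ∑ i, π i * expectedPayoff r a 1 (signalStrategy f σ) τ (n + 1) (m + 1) (k i) (h i) =
      σ o * inspectLoss r a n m π k (fun i => τ (h i))
        + (1 - σ o) * skipLoss r a n m π k (fun i => τ (h i)) := by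
  rw [H.inspector_loss_eq hr0 hm]
  congr 1
  · rcases (σ o).2.1.eq_or_lt with h0 | h0
    · rw [← h0, zero_mul, zero_mul]
    · have h1 := (ih m _ _ _ _ (H.after_inspect hr0 hf hm h0)).1
      congr 1
      rw [inspectLoss]
      simp only [mul_add, Finset.sum_add_distrib, ← mul_assoc]
      rw [h1]
  · rcases (sub_nonneg.mpr (σ o).2.2).eq_or_lt with h0 | h0
    · rw [← h0, zero_mul, zero_mul]
    · have h1 := (H.payoffs_after_skip hr0 hf hm (ih (m + 1)) h0).1
      congr 1
      rw [skipLoss]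
      simp only [mul_add, Finset.sum_add_distrib, ← mul_assoc]
      linarith

lemma inspectee_payoff_eq_of_value (hr0 : r 0 = 0) (hf : ∀ z, f (.inspect, .legal) ≠ f (.skip, z))
    (hm : m + 1 ≤ n)
    (ih : ∀ (m : ℕ) (o : List α) {ι : Type} [Fintype ι] (π : ι → ℝ) (k : ι → ℕ)
      (h : ι → History), IsContinuationEquilibrium f r a b n m o π k h σ τ →
        HasValuePayoffs f r a b n m π k h σ τ)
    (H : IsContinuationEquilibrium f r a b (n + 1) (m + 1) o π k h σ τ)
    {i : ι} (hi : 0 < π i) :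
    expectedPayoff r (-b) 1 (signalStrategy f σ) τ (n + 1) (m + 1) (k i) (h i) =
      (1 - τ (h i)) * (σ o * value b r n m (k i) + (1 - σ o) * value b r n (m + 1) (k i))
        + τ (h i) * (σ o * (-b * r (k i))
          + (1 - σ o) * (r (k i) + value b r n (m + 1) (k i - 1))) := by
  rw [H.inspectee_payoff_eq hr0 hm]
  have hp0 := (σ o).2.1
  have hp1 := sub_nonneg.mpr (σ o).2.2
  have hq0 := (τ (h i)).2.1
  have hq1 := sub_nonneg.mpr (τ (h i)).2.2
  have e1 : (σ o : ℝ) * ((1 - τ (h i)) *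
      (expectedPayoff r (-b) 1 (signalStrategy f σ) τ n m (k i) ((.inspect, .legal) :: h i)
        - value b r n m (k i))) = 0 := by
    rcases hp0.eq_or_lt with h0 | h0
    · rw [← h0, zero_mul]
    rcases hq1.eq_or_lt with h1 | h1
    · rw [← h1, zero_mul, mul_zero]
    · rw [(ih m _ _ _ _ (H.after_inspect hr0 hf hm h0)).2 i (mul_pos hi h1)]
      ring
  have e2 : (1 - σ o : ℝ) * ((1 - τ (h i)) *
      (expectedPayoff r (-b) 1 (signalStrategy f σ) τ n (m + 1) (k i) ((.skip, .legal) :: h i)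
        - value b r n (m + 1) (k i))) = 0 := by
    rcases hp1.eq_or_lt with h0 | h0
    · rw [← h0, zero_mul]
    rcases hq1.eq_or_lt with h1 | h1
    · rw [← h1, zero_mul, mul_zero]
    · rw [(H.payoffs_after_skip hr0 hf hm (ih (m + 1)) h0).2.1 i (mul_pos hi h1)]
      ring
  have e3 : (1 - σ o : ℝ) * (τ (h i) *
      (expectedPayoff r (-b) 1 (signalStrategy f σ) τ n (m + 1) (k i - 1)
        ((.skip, .violate) :: h i) - value b r n (m + 1) (k i - 1))) = 0 := by
    rcases hp1.eq_or_lt with h0 | h0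
    · rw [← h0, zero_mul]
    rcases hq0.eq_or_lt with h1 | h1
    · rw [← h1, zero_mul, mul_zero]
    · rw [(H.payoffs_after_skip hr0 hf hm (ih (m + 1)) h0).2.2 i (mul_pos hi h1)]
      ring
  linear_combination e1 + e2 + e3

end IsContinuationEquilibrium

end

/-! ### Incentives in the current period -/

section

variable {r : ℕ → ℝ} {n m k : ℕ}

/-- The advantage of legal action over violation, when the current period is inspected with
probability `p` and the continuation payoffs are the claimed ones, is a positive multiple of
`p - inspectProb b n m`. Hence an inspectee who can still gain acts legally only if `p` is at least
`inspectProb b n m`, and violates only if `p` is at most that. -/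
lemma legal_sub_violate_sign {b : ℝ} (hr : ∀ i, 0 ≤ r i) (hr0 : r 0 = 0) (hb : 0 ≤ b)
    (hm : m + 1 ≤ n) (ht : 0 < t r (n + 1) (m + 1) k) (p : ℝ) :
    ∃ C : ℝ, 0 < C ∧
      p * value b r n m k + (1 - p) * value b r n (m + 1) k
        - (p * (-b * r k) + (1 - p) * (r k + value b r n (m + 1) (k - 1))) =
      C * (p - inspectProb b n m) := by
  have hb' : -1 < b := by linarith
  have h1 := value_legal (r := r) (k := k) hb' hm
  have h2 := value_violate (k := k) hb' hr0 hm
  have h3 : 0 < value b r n m k := div_pos (t_pos_of_t_pos hr hm ht) (s_pos hb' (by omega))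
  have h4 := mul_nonneg hb (hr k)
  have h5 := inspectProb_pos hb' hm
  have h6 := inspectProb_lt_one hb' hm
  set A := value b r n m k + b * r k with hA
  set B := r k + value b r n (m + 1) (k - 1) - value b r n (m + 1) k with hB
  have h7 : 0 < A := by linarith
  have h8 : inspectProb b n m * A = (1 - inspectProb b n m) * B := by
    rw [hA, hB]
    linear_combination h1 - h2
  have h9 : 0 < B := by
    refine pos_of_mul_pos_right (a := 1 - inspectProb b n m) ?_ (by linarith)
    rw [← h8]
    exact mul_pos h5 h7
  refine ⟨A + B, by linarith, ?_⟩
  rw [hA, hB] at h8 ⊢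
  linear_combination h8

/-- Against a violation that matters, the inspector prefers to inspect. -/
lemma caught_lt_uncaught {a : ℝ} (hr : ∀ i, 0 ≤ r i) (hr0 : r 0 = 0) (ha1 : a < 1)
    (hm : m + 1 ≤ n) (ht : 0 < t r (n + 1) (m + 1) k) :
    a * r k < r k + value (-a) r n (m + 1) (k - 1) := by
  have ha' : -1 < -a := by linarith
  rcases (hr k).eq_or_lt with h0 | h0
  · rw [t_succ_left hr0, ← h0, zero_mul, zero_add] at ht
    rw [← h0, mul_zero, zero_add]
    exact div_pos ht (s_pos ha' hm)
  · have h1 : 0 ≤ value (-a) r n (m + 1) (k - 1) := value_nonneg ha' hr hm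
    have h2 := mul_lt_mul_of_pos_right ha1 h0
    linarith

end

/-! ### Uniqueness of the equilibrium payoffs -/

variable {α : Type} {f : InspectorAction × InspecteeAction → α} {r : ℕ → ℝ} {a b : ℝ}

/-- Where a type of positive weight can still gain, the inspection probability makes that type
indifferent: with less inspection all such types would violate, and the inspector would rather
inspect; with more they would all act legally, and he would rather not inspect. -/
lemma IsContinuationEquilibrium.inspection_eq (hr : ∀ i, 0 ≤ r i) (hr0 : r 0 = 0) (ha1 : a < 1)
    (hb : 0 ≤ b) (hf : ∀ z, f (.inspect, .legal) ≠ f (.skip, z)) {n m : ℕ} (hm : m + 1 ≤ n)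
    {o : List α} {ι : Type} [Fintype ι] {π : ι → ℝ} {k : ι → ℕ} {h : ι → History}
    {σ : List α → unitInterval} {τ : InspecteeStrategy}
    (ih : ∀ (m : ℕ) (o : List α) {ι : Type} [Fintype ι] (π : ι → ℝ) (k : ι → ℕ)
      (h : ι → History), IsContinuationEquilibrium f r a b n m o π k h σ τ →
        HasValuePayoffs f r a b n m π k h σ τ)
    (H : IsContinuationEquilibrium f r a b (n + 1) (m + 1) o π k h σ τ)
    (hact : ∃ i, 0 < π i ∧ 0 < t r (n + 1) (m + 1) (k i)) :
    (σ o : ℝ) = inspectProb b n m := by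
  have ha' : -1 < -a := by linarith
  have hb' : -1 < b := by linarith
  have hloss := H.inspector_loss_eq_of_value hr0 hf hm ih
  obtain ⟨i₀, hi₀, ht₀⟩ := hact
  -- the terms of types that can no longer gain vanish
  have hzero : ∀ i, ¬ 0 < t r (n + 1) (m + 1) (k i) → r (k i) = 0 ∧ value (-a) r n m (k i) = 0 ∧
      value (-a) r n (m + 1) (k i) = 0 ∧ value (-a) r n (m + 1) (k i - 1) = 0 := by
    intro i hi
    obtain ⟨h1, h2, h3, h4⟩ := eq_zero_of_t_eq_zero hr hr0 hm
      (le_antisymm (not_lt.mp hi) (t_nonneg hr _ _ _))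
    refine ⟨h1, ?_, ?_, ?_⟩ <;> simp [value, h2, h3, h4]
  rcases lt_trichotomy (σ o : ℝ) (inspectProb b n m) with hp | hp | hp
  · exfalso
    have hq : ∀ i, 0 < π i → 0 < t r (n + 1) (m + 1) (k i) → (τ (h i) : ℝ) = 1 := by
      intro i hi ht
      obtain ⟨C, hC, hC'⟩ := legal_sub_violate_sign hr hr0 hb hm ht (σ o)
      have h1 := H.inspectee_payoff_eq_of_value hr0 hf hm ih hi
      have h2 := H.le_inspectee_payoff hr hr0 hb hm hi 1
      have h3 := mul_neg_of_pos_of_neg hC (sub_neg.mpr hp)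
      by_contra hne
      have h4 : 0 < (1 - τ (h i) : ℝ) := sub_pos.mpr (lt_of_le_of_ne (τ (h i)).2.2 hne)
      have h5 := mul_neg_of_pos_of_neg h4 (hC' ▸ h3)
      rw [h1] at h2
      simp only [Set.Icc.coe_one] at h2
      linarith
    have hlt : inspectLoss r a n m π k (fun i => τ (h i)) <
        skipLoss r a n m π k (fun i => τ (h i)) := by
      have key : ∀ i, 0 < π i → 0 < t r (n + 1) (m + 1) (k i) →
          π i * ((1 - τ (h i)) * value (-a) r n m (k i) + τ (h i) * (a * r (k i))) <
          π i * ((1 - τ (h i)) * value (-a) r n (m + 1) (k i)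
            + τ (h i) * (r (k i) + value (-a) r n (m + 1) (k i - 1))) := by
        intro i hi ht
        rw [hq i hi ht]
        have := caught_lt_uncaught hr hr0 ha1 hm ht
        exact mul_lt_mul_of_pos_left (by linarith) hi
      refine Finset.sum_lt_sum (fun i _ => ?_) ⟨i₀, Finset.mem_univ _, key i₀ hi₀ ht₀⟩
      rcases (H.nonneg i).eq_or_lt with h0 | h0
      · simp [← h0]
      · by_cases ht : 0 < t r (n + 1) (m + 1) (k i)
        · exact (key i h0 ht).le
        · obtain ⟨e1, e2, e3, e4⟩ := hzero i ht
          simp [e1, e2, e3, e4]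
    have hdev := H.inspector_loss_le hr0 ha1 hf hm 1
    rw [hloss] at hdev
    have h1 : 0 < (1 - σ o : ℝ) := by linarith [inspectProb_lt_one hb' hm]
    have h2 := mul_lt_mul_of_pos_left hlt h1
    simp only [Set.Icc.coe_one] at hdev
    linarith
  · exact hp
  · exfalso
    have hq : ∀ i, 0 < π i → 0 < t r (n + 1) (m + 1) (k i) → (τ (h i) : ℝ) = 0 := by
      intro i hi ht
      obtain ⟨C, hC, hC'⟩ := legal_sub_violate_sign hr hr0 hb hm ht (σ o)
      have h1 := H.inspectee_payoff_eq_of_value hr0 hf hm ih hi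
      have h2 := H.le_inspectee_payoff hr hr0 hb hm hi 0
      have h3 := mul_pos hC (sub_pos.mpr hp)
      by_contra hne
      have h4 : 0 < (τ (h i) : ℝ) := lt_of_le_of_ne (τ (h i)).2.1 (Ne.symm hne)
      have h5 := mul_pos h4 (hC' ▸ h3)
      rw [h1] at h2
      simp only [Set.Icc.coe_zero] at h2
      linarith
    have hlt : skipLoss r a n m π k (fun i => τ (h i)) <
        inspectLoss r a n m π k (fun i => τ (h i)) := by
      have key : ∀ i, 0 < π i → 0 < t r (n + 1) (m + 1) (k i) →
          π i * ((1 - τ (h i)) * value (-a) r n (m + 1) (k i)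
            + τ (h i) * (r (k i) + value (-a) r n (m + 1) (k i - 1))) <
          π i * ((1 - τ (h i)) * value (-a) r n m (k i) + τ (h i) * (a * r (k i))) := by
        intro i hi ht
        rw [hq i hi ht]
        have := value_succ_lt ha' hr hm (t_pos_of_t_pos hr hm ht)
        exact mul_lt_mul_of_pos_left (by linarith) hi
      refine Finset.sum_lt_sum (fun i _ => ?_) ⟨i₀, Finset.mem_univ _, key i₀ hi₀ ht₀⟩
      rcases (H.nonneg i).eq_or_lt with h0 | h0
      · simp [← h0]
      · by_cases ht : 0 < t r (n + 1) (m + 1) (k i)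
        · exact (key i h0 ht).le
        · obtain ⟨e1, e2, e3, e4⟩ := hzero i ht
          simp [e1, e2, e3, e4]
    have hdev := H.inspector_loss_le hr0 ha1 hf hm 0
    rw [hloss] at hdev
    have h1 : 0 < (σ o : ℝ) := by linarith [inspectProb_pos hb' hm]
    have h2 := mul_lt_mul_of_pos_left hlt h1
    simp only [Set.Icc.coe_zero] at hdev
    linarith

/-- The payoffs of an equilibrium are unique at every information set. -/
lemma IsContinuationEquilibrium.hasValuePayoffs (hr : ∀ i, 0 ≤ r i) (hr0 : r 0 = 0)
    (ha1 : a < 1) (hb : 0 ≤ b) (hf : ∀ z, f (.inspect, .legal) ≠ f (.skip, z)) {n m : ℕ}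
    {o : List α} {ι : Type} [Fintype ι] {π : ι → ℝ} {k : ι → ℕ} {h : ι → History}
    {σ : List α → unitInterval} {τ : InspecteeStrategy}
    (H : IsContinuationEquilibrium f r a b n m o π k h σ τ) :
    HasValuePayoffs f r a b n m π k h σ τ := by
  have ha' : -1 < -a := by linarith
  have hb' : -1 < b := by linarith
  induction n generalizing m o ι with
  | zero =>
    exact ⟨Finset.sum_congr rfl fun i _ => by
        rw [expectedPayoff_eq_value_of_trivial _ _ (-a) _ _ _ _ (Or.inl (Nat.zero_le m))],
      fun i _ => expectedPayoff_eq_value_of_trivial _ _ _ _ _ _ _ (Or.inl (Nat.zero_le m))⟩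
  | succ n ih =>
    by_cases htriv : n + 1 ≤ m ∨ m = 0
    · exact ⟨Finset.sum_congr rfl fun i _ => by
          rw [expectedPayoff_eq_value_of_trivial _ _ (-a) _ _ _ _ htriv],
        fun i _ => expectedPayoff_eq_value_of_trivial _ _ _ _ _ _ _ htriv⟩
    obtain ⟨m, rfl⟩ : ∃ m', m = m' + 1 := ⟨m - 1, by omega⟩
    have hm : m + 1 ≤ n := by omega
    have ih' : ∀ (m : ℕ) (o : List α) {ι : Type} [Fintype ι] (π : ι → ℝ) (k : ι → ℕ)
        (h : ι → History), IsContinuationEquilibrium f r a b n m o π k h σ τ →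
          HasValuePayoffs f r a b n m π k h σ τ := fun _ _ _ _ _ _ _ H => ih H
    have hinact : ∀ i, ¬ 0 < t r (n + 1) (m + 1) (k i) → ∀ c x,
        expectedPayoff r c 1 (signalStrategy f σ) τ (n + 1) (m + 1) (k i) (h i) =
          value x r (n + 1) (m + 1) (k i) := by
      intro i hi c x
      have ht := le_antisymm (not_lt.mp hi) (t_nonneg hr (n + 1) (m + 1) (k i))
      rw [expectedPayoff_eq_zero hr hr0 _ _ _ _ _ _ _ ht, value, ht, zero_div]
    by_cases hact : ∃ i, 0 < π i ∧ 0 < t r (n + 1) (m + 1) (k i)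
    · have hp := H.inspection_eq hr hr0 ha1 hb hf hm ih' hact
      have hp0 := inspectProb_pos hb' hm
      have hp1 := inspectProb_lt_one hb' hm
      refine ⟨?_, fun i hi => ?_⟩
      · have hloss := H.inspector_loss_eq_of_value hr0 hf hm ih'
        have hd0 := H.inspector_loss_le hr0 ha1 hf hm 0
        have hd1 := H.inspector_loss_le hr0 ha1 hf hm 1
        have hvalue : inspectProb (-a) n m * inspectLoss r a n m π k (fun i => τ (h i))
            + (1 - inspectProb (-a) n m) * skipLoss r a n m π k (fun i => τ (h i)) =
            ∑ i, π i * value (-a) r (n + 1) (m + 1) (k i) := by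
          rw [inspectLoss, skipLoss, Finset.mul_sum, Finset.mul_sum, ← Finset.sum_add_distrib]
          refine Finset.sum_congr rfl fun i _ => ?_
          have h1 := value_legal (r := r) (k := k i) ha' hm
          have h2 := value_violate (k := k i) ha' hr0 hm
          linear_combination π i * ((1 - τ (h i) : ℝ) * h1 + (τ (h i) : ℝ) * h2)
        rw [hloss] at hd0 hd1 ⊢
        rw [← hvalue]
        simp only [Set.Icc.coe_zero, Set.Icc.coe_one] at hd0 hd1
        rw [hp] at hd0 hd1 ⊢
        -- both actions of the inspector have positive probability, so they are equally good
        have heq : inspectLoss r a n m π k (fun i => τ (h i)) =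
            skipLoss r a n m π k (fun i => τ (h i)) := by
          refine le_antisymm (le_of_mul_le_mul_left ?_ hp0)
            (le_of_mul_le_mul_left ?_ (sub_pos.mpr hp1)) <;> linarith
        rw [heq]
        ring
      · by_cases ht : 0 < t r (n + 1) (m + 1) (k i)
        · rw [H.inspectee_payoff_eq_of_value hr0 hf hm ih' hi, hp, value_legal hb' hm,
            value_violate hb' hr0 hm]
          ring
        · exact hinact i ht _ _
    · push Not at hact
      refine ⟨Finset.sum_congr rfl fun i _ => ?_,
        fun i hi => hinact i (not_lt.mpr (hact i hi)) _ _⟩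
      rcases (H.nonneg i).eq_or_lt with h0 | h0
      · rw [← h0, zero_mul, zero_mul]
      · rw [hinact i (not_lt.mpr (hact i h0)) _ (-a)]

lemma v_eq_neg_value (a : ℝ) (r : ℕ → ℝ) (n m k : ℕ) : v a r n m k = -value (-a) r n m k := by
  rw [v, value]
  split_ifs with h
  · rw [t_eq_zero_of_le r k h, zero_div, neg_zero]
  · rw [neg_div]

lemma w_eq_value (b : ℝ) (r : ℕ → ℝ) (n m k : ℕ) : w b r n m k = value b r n m k := by
  rw [w, value]
  split_ifs with h
  · rw [t_eq_zero_of_le r k h, zero_div]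
  · rfl

/-- Uniqueness of the equilibrium payoffs for any signals that let the inspector recall his own
actions. -/
theorem payoffs_eq_of_isNashEquilibrium (f : InspectorAction × InspecteeAction → α)
    (hf : ∀ z, f (.inspect, .legal) ≠ f (.skip, z)) (n m k : ℕ) (ha1 : a < 1) (hb : 0 ≤ b)
    (hr : ∀ i, 1 ≤ i → i ≤ k → 0 ≤ r i) (σ : List α → unitInterval) (τ : InspecteeStrategy)
    (H : IsNashEquilibrium
      (fun σ₁ τ₁ => inspectorPayoff n m k a r (signalStrategy f σ₁) τ₁)
      (fun σ₁ τ₁ => inspecteePayoff n m k b r (signalStrategy f σ₁) τ₁) σ τ) :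
    inspectorPayoff n m k a r (signalStrategy f σ) τ = v a r n m k ∧
      inspecteePayoff n m k b r (signalStrategy f σ) τ = w b r n m k := by
  -- rewards with an index outside `1, …, k` are irrelevant, and may be replaced by `0`
  set r' : ℕ → ℝ := fun i => if 1 ≤ i ∧ i ≤ k then r i else 0 with hr'
  have hrr' : ∀ i, 1 ≤ i → i ≤ k → r i = r' i := fun i h1 h2 => (if_pos ⟨h1, h2⟩).symm
  have hpos : ∀ i, 0 ≤ r' i := by
    intro i
    simp only [hr']
    split_ifs with h
    exacts [hr i h.1 h.2, le_rfl]
  have h0 : r' 0 = 0 := by simp [hr']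
  have h1 : ∀ σ τ, inspectorPayoff n m k a r σ τ = -expectedPayoff r' a 1 σ τ n m k [] :=
    fun σ τ => by
      rw [inspectorPayoff, expectedPayoff_neg, expectedPayoff_congr_reward _ _ _ _ _ _ _ _ hrr']
  have h2 : ∀ σ τ, inspecteePayoff n m k b r σ τ = expectedPayoff r' (-b) 1 σ τ n m k [] :=
    fun σ τ => expectedPayoff_congr_reward _ _ _ _ _ _ _ _ hrr'
  simp only [IsNashEquilibrium, h1, h2, neg_le_neg_iff] at H
  have E : IsContinuationEquilibrium f r' a b n m [] (fun _ : Unit => 1) (fun _ => k)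
      (fun _ => []) σ τ :=
    { signals := fun _ => rfl
      nonneg := fun _ => zero_le_one
      inspector := fun σ' => by simpa using H.1 σ'
      inspectee := fun _ _ => H.2 }
  obtain ⟨h3, h4⟩ := E.hasValuePayoffs hpos h0 ha1 hb hf
  have ht : ∀ x, value x r' n m k = value x r n m k := fun x => by
    rw [value, value, t_congr_reward n m k hrr']
  rw [h1, h2, v_eq_neg_value, w_eq_value, ← ht, ← ht]
  exact ⟨by simpa using h3, h4 () zero_lt_one⟩

end InspectionGame

theorem mainTheorem4 (n m k : ℕ) (a b : ℝ) (ha0 : 0 < a) (ha1 : a < 1) (hb : 0 ≤ b)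
    (r : ℕ → ℝ) (hr : ∀ i, 1 ≤ i → i ≤ k → 0 ≤ r i) :
    (∀ (σ : InspectionGame.InspectorStrategy) (τ : InspectionGame.InspecteeStrategy),
      InspectionGame.IsNashEquilibrium
          (InspectionGame.inspectorPayoff n m k a r)
          (InspectionGame.inspecteePayoff n m k b r) σ τ →
        InspectionGame.inspectorPayoff n m k a r σ τ = InspectionGame.v a r n m k ∧
        InspectionGame.inspecteePayoff n m k b r σ τ = InspectionGame.w b r n m k) ∧
    (∀ (σ : InspectionGame.UninformedInspectorStrategy) (τ : InspectionGame.InspecteeStrategy),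
      InspectionGame.IsNashEquilibrium
          (fun σ₁ τ₁ => InspectionGame.inspectorPayoff n m k a r σ₁.toInspectorStrategy τ₁)
          (fun σ₁ τ₁ => InspectionGame.inspecteePayoff n m k b r σ₁.toInspectorStrategy τ₁) σ τ →
        InspectionGame.inspectorPayoff n m k a r σ.toInspectorStrategy τ =
          InspectionGame.v a r n m k ∧
        InspectionGame.inspecteePayoff n m k b r σ.toInspectorStrategy τ =
          InspectionGame.w b r n m k) := by
  refine ⟨fun σ τ H => ?_, fun σ τ H => ?_⟩
  · have hid : ∀ σ₁ : InspectionGame.InspectorStrategy,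
        InspectionGame.signalStrategy id σ₁ = σ₁ := fun σ₁ => by
      funext h
      rw [InspectionGame.signalStrategy, List.map_id]
    have := InspectionGame.payoffs_eq_of_isNashEquilibrium id (by simp) n m k ha1 hb hr σ τ
      (by simpa only [hid] using H)
    rwa [hid] at this
  · exact InspectionGame.payoffs_eq_of_isNashEquilibrium Prod.fst (by simp) n m k ha1 hb hr σ τ H
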